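/- Let $M$ be a complex Banach manifold and let $E=\bigcup_{p\in M}E_p$ be a complex (that is, holomorphic) subbundle of the holomorphic tangent bundle $TM$: around every point of $M$ there is a holomorphic vector bundle trivialization of $TM$ over an open set $W$, with fibre the model Banach space $X$ of $M$, which carries $E|_W$ onto $W\times K$ for some closed complemented subspace $K\subseteq X$. Suppose that $E$ has the following property: if $V$ is an open subset of $M$ and $\xi,\eta\colon V\to TM$ are holomorphic vector fields on $V$ such that $\xi(p),\eta(p)\in E_p$ for all $p\in V$, then $[\xi,\eta](p)\in E_p$ for all $p\in V$. Then for every $m\in M$ there exist an open neighborhood $U$ of $m$, a complex Banach space $F$ and a holomorphic submersion $\zeta\colon U\to F$ such that $$E_p=\operatorname{Ker}(T_p\zeta)=T_p\bigl(\zeta^{-1}(\zeta(p))\bigr)\quad\text{for all }p\in U .$$ -/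

import Mathlib

open scoped Manifold ContDiff Topology

universe u v

section HolomorphicFrobenius

variable {X : Type u} [NormedAddCommGroup X] [NormedSpace ℂ X]
  {M : Type v} [TopologicalSpace M] [ChartedSpace X M] [IsManifold 𝓘(ℂ, X) ω M]

/-- `E = ⋃ E_p` is a (split) holomorphic subbundle of `TM`: around every point `m` there are a
holomorphic vector bundle trivialization `e` of `TM` over an open set (`e.baseSet`) containing `m`
and a closed complemented subspace `K` of the model space `X` such that, over each point `p` of
that open set, `e` carries `E_p` onto `K`. -/
def IsHolomorphicSubbundle (E : ∀ p : M, Submodule ℂ (TangentSpace 𝓘(ℂ, X) p)) : Prop :=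
  ∀ m : M,
    ∃ e : Bundle.Trivialization X (Bundle.TotalSpace.proj : TangentBundle 𝓘(ℂ, X) M → M),
      m ∈ e.baseSet ∧ e.IsLinear ℂ ∧
      ContMDiffOn 𝓘(ℂ, X).tangent (𝓘(ℂ, X).prod 𝓘(ℂ, X)) ω e e.source ∧
      ContMDiffOn (𝓘(ℂ, X).prod 𝓘(ℂ, X)) 𝓘(ℂ, X).tangent ω
        e.toOpenPartialHomeomorph.symm e.target ∧
      ∃ K : Submodule ℂ X, K.ClosedComplemented ∧
        ∀ p ∈ e.baseSet, ∀ v : TangentSpace 𝓘(ℂ, X) p,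
          v ∈ E p ↔ (e (⟨p, v⟩ : TangentBundle 𝓘(ℂ, X) M)).2 ∈ K

/-- `ξ` is a holomorphic vector field on `V`. Its values outside `V` are irrelevant. -/
def IsHolomorphicVectorFieldOn (ξ : ∀ p : M, TangentSpace 𝓘(ℂ, X) p) (V : Set M) : Prop :=
  ContMDiffOn 𝓘(ℂ, X) 𝓘(ℂ, X).tangent ω
    (fun p => (⟨p, ξ p⟩ : TangentBundle 𝓘(ℂ, X) M)) V

/-- The Lie bracket of any two holomorphic vector fields on an open set `V` with values in `E`
again has values in `E`. -/
def IsHolomorphicallyInvolutive (E : ∀ p : M, Submodule ℂ (TangentSpace 𝓘(ℂ, X) p)) : Prop :=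
  ∀ V : Set M, IsOpen V → ∀ ξ η : ∀ p : M, TangentSpace 𝓘(ℂ, X) p,
    IsHolomorphicVectorFieldOn ξ V → IsHolomorphicVectorFieldOn η V →
    (∀ p ∈ V, ξ p ∈ E p) → (∀ p ∈ V, η p ∈ E p) →
    ∀ p ∈ V, VectorField.mlieBracket 𝓘(ℂ, X) ξ η p ∈ E p

/-- Near its point `p`, the set `S` is a (split) complex submanifold of `M`, and `T` is the tangent
space `T_p S`, regarded as a subspace of `T_p M`: in some holomorphic chart `φ` of `M` around `p`
the set `S` is the affine slice `φ p + K` for a closed complemented subspace `K` of the model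
space, and `T` is the subspace of `T_p M` corresponding to `K` under the differential of `φ`. -/
def IsSubmanifoldTangentSpaceAt (S : Set M) (p : M)
    (T : Submodule ℂ (TangentSpace 𝓘(ℂ, X) p)) : Prop :=
  p ∈ S ∧
    ∃ φ ∈ IsManifold.maximalAtlas 𝓘(ℂ, X) ω M, p ∈ φ.source ∧
      ∃ K : Submodule ℂ X, K.ClosedComplemented ∧
        (∀ q ∈ φ.source, q ∈ S ↔ φ q - φ p ∈ K) ∧
        ∀ v : TangentSpace 𝓘(ℂ, X) p, v ∈ T ↔ mfderiv 𝓘(ℂ, X) 𝓘(ℂ, X) φ p v ∈ K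

end HolomorphicFrobenius

/-!
The theorem is the Frobenius theorem for analytic Banach manifolds: around each point there is a
holomorphic chart in which the subbundle is a constant complemented subspace `K`
(`exists_flat_chart`). The projection of that chart to a complement of `K` is then the required
submersion, and its fibres are the slices of the chart parallel to `K`.

In a chart of `M`, the trivialization exhibits the subbundle as the set of vectors that an operator
`T x`, depending analytically on `x`, maps into `K` (`IsHolomorphicSubbundle.exists_coordinates`).
After splitting the model space as `A × B`, the subbundle is the family of the graphs of operators
`f z : A → B` (`exists_graph_of_kernel`). Its sections `(h, f z h)` with constant `h` have brackets
with first component zero, so involutivity says precisely that `Df(z)(h, f z h) k` is symmetric in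
`h` and `k`.

A leaf is the graph of a map `x ↦ α (x, y)` with `D₁α = f (x, α)` and `α (0, y) = y`. To find it,
the equation is solved along rays: `γ' t = f (t x, γ t) x`, `γ 0 = y`, and `α (x, y) = γ 1`. The
symmetry of `Df` implies by a Grönwall argument that the `x`-derivative of `γ t` in the direction
`h` is `t f (t x, γ t) h` (`linearized_radial_solution_eq`), which at `t = 1` is the equation for
`α`. The inverse of `(x, y) ↦ (x, α (x, y))` straightens the subbundle (`exists_straightening`).

The analytic dependence of the solution on `(x, y)` comes from the analytic implicit function
theorem, applied to the integral equation in the Banach space `C([0, 1], B)`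
(`exists_analytic_radial_solution`). This requires the superposition operator of an analytic map to
be analytic, which is seen from its pointwise power series (`AnalyticAt.exists_superposition`).
-/

/-! ### Superposition operators on spaces of continuous maps -/

section Superposition

variable {K : Type*} [TopologicalSpace K] [CompactSpace K]
  {P : Type*} [NormedAddCommGroup P] [NormedSpace ℂ P]
  {Q : Type*} [NormedAddCommGroup Q] [NormedSpace ℂ Q]

/-- The formal multilinear series on `C(K, P)` obtained by applying the terms of `p` pointwise. -/
noncomputable def FormalMultilinearSeries.pointwise (K : Type*) [TopologicalSpace K]
    [CompactSpace K] (p : FormalMultilinearSeries ℂ P Q) :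
    FormalMultilinearSeries ℂ C(K, P) C(K, Q) := fun n =>
  MultilinearMap.mkContinuous
    { toFun := fun m => ⟨fun t => p n fun i => m i t, by fun_prop⟩
      map_update_add' := by
        intro _ m i a b
        ext t
        have h : ∀ c : C(K, P), (fun j => Function.update m i c j t) =
            Function.update (fun j => m j t) i (c t) := by
          intro c; ext j; by_cases hj : j = i
          · subst hj; simp
          · simp [hj]
        simp [h]
      map_update_smul' := by
        intro _ m i r a
        ext t
        have h : ∀ c : C(K, P), (fun j => Function.update m i c j t) =
            Function.update (fun j => m j t) i (c t) := by
          intro c; ext j; by_cases hj : j = i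
          · subst hj; simp
          · simp [hj]
        simp [h] }
    ‖p n‖ (by
      intro m
      refine (ContinuousMap.norm_le _ (by positivity)).2 fun t => ?_
      refine ((p n).le_opNorm _).trans ?_
      gcongr with i
      exact (m i).norm_coe_le_norm t)

theorem FormalMultilinearSeries.radius_le_radius_pointwise (p : FormalMultilinearSeries ℂ P Q) :
    p.radius ≤ (p.pointwise K).radius :=
  FormalMultilinearSeries.radius_le_of_le fun _ =>
    MultilinearMap.mkContinuous_norm_le _ (norm_nonneg _) _

/-- The superposition operator `γ ↦ f ∘ γ` of an analytic map is analytic for the supremum norm: its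
Taylor series at `0` is the pointwise Taylor series of `f`. As `f` is only controlled near `0`, the
operator is only prescribed on curves close to `0`. -/
theorem AnalyticAt.exists_superposition [CompleteSpace Q] {f : P → Q} (hf : AnalyticAt ℂ f 0) :
    ∃ N : C(K, P) → C(K, Q), AnalyticAt ℂ N 0 ∧
      ∀ᶠ γ in 𝓝 (0 : C(K, P)), (∀ t, N γ t = f (γ t)) ∧
        ∀ η t, fderiv ℂ N γ η t = fderiv ℂ f (γ t) (η t) := by
  obtain ⟨p, r, hp⟩ := hf
  have hpos : 0 < (p.pointwise K).radius :=
    hp.r_pos.trans_le (hp.r_le.trans p.radius_le_radius_pointwise)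
  have hN := (p.pointwise K).hasFPowerSeriesOnBall hpos
  have hball : ∀ γ ∈ Metric.eball (0 : C(K, P)) r, ∀ t, γ t ∈ Metric.eball (0 : P) r := by
    intro γ hγ t
    rw [mem_eball_zero_iff] at hγ ⊢
    refine lt_of_le_of_lt ?_ hγ
    exact enorm_le_iff_norm_le.2 (γ.norm_coe_le_norm t)
  have heval : ∀ γ ∈ Metric.eball (0 : C(K, P)) r, ∀ t, (p.pointwise K).sum γ t = f (γ t) := by
    intro γ hγ t
    have h1 := hN.hasSum (Metric.eball_subset_eball
      (hp.r_le.trans p.radius_le_radius_pointwise) hγ)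
    have h2 := h1.mapL (ContinuousMap.evalCLM ℂ t)
    have h3 := hp.hasSum (hball γ hγ t)
    rw [zero_add] at h2 h3
    exact h2.unique h3
  refine ⟨(p.pointwise K).sum, hN.analyticAt, ?_⟩
  filter_upwards [Metric.eball_mem_nhds (0 : C(K, P)) hp.r_pos,
    hN.analyticAt.eventually_analyticAt] with γ hγ hNγ
  refine ⟨heval γ hγ, fun η t => ?_⟩
  have hd1 : HasFDerivAt (fun c : C(K, P) => (p.pointwise K).sum c t)
      ((ContinuousMap.evalCLM ℂ t).comp (fderiv ℂ (p.pointwise K).sum γ)) γ :=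
    (ContinuousMap.evalCLM ℂ t : C(K, Q) →L[ℂ] Q).hasFDerivAt.comp γ
      hNγ.differentiableAt.hasFDerivAt
  have hfγ : AnalyticAt ℂ f (γ t) := hp.analyticAt_of_mem (hball γ hγ t)
  have hd2 : HasFDerivAt (fun c : C(K, P) => f (c t))
      ((fderiv ℂ f (γ t)).comp (ContinuousMap.evalCLM ℂ t : C(K, P) →L[ℂ] P)) γ :=
    HasFDerivAt.comp (g := f) γ hfγ.differentiableAt.hasFDerivAt
      (ContinuousMap.evalCLM ℂ t : C(K, P) →L[ℂ] P).hasFDerivAt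
  have hd3 := hd2.congr_of_eventuallyEq (f₁ := fun c : C(K, P) => (p.pointwise K).sum c t) (by
    filter_upwards [Metric.isOpen_eball.mem_nhds hγ] with c hc using heval c hc t)
  exact congrArg (fun l => l η) (hd1.unique hd3)

end Superposition

/-! ### Integration of curves -/

section Integration

open unitInterval

variable {B : Type*} [NormedAddCommGroup B] [NormedSpace ℂ B] 

/-- The primitive `t ↦ ∫₀ᵗ γ` of a curve on the unit interval, as a function on `ℝ`, where `γ` is
extended to `ℝ` by constants. -/
noncomputable def ContinuousMap.primitive (γ : C(I, B)) (t : ℝ) : B :=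
  ∫ s in (0 : ℝ)..t, Set.IccExtend zero_le_one γ s

theorem ContinuousMap.hasDerivAt_primitive [CompleteSpace B] (γ : C(I, B)) (t : ℝ) :
    HasDerivAt γ.primitive (Set.IccExtend zero_le_one γ t) t :=
  have hc : Continuous (Set.IccExtend zero_le_one γ) := γ.continuous.Icc_extend'
  intervalIntegral.integral_hasDerivAt_right (hc.intervalIntegrable _ _)
    hc.stronglyMeasurable.stronglyMeasurableAtFilter hc.continuousAt

theorem ContinuousMap.norm_primitive_le (γ : C(I, B)) (t : I) : ‖γ.primitive t‖ ≤ ‖γ‖ := by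
  have h := intervalIntegral.norm_integral_le_of_norm_le_const (a := 0) (b := (t : ℝ)) (C := ‖γ‖)
    (f := Set.IccExtend zero_le_one γ) fun s _ => γ.norm_coe_le_norm _
  refine h.trans (mul_le_of_le_one_right (norm_nonneg _) ?_)
  rw [sub_zero, abs_of_nonneg t.2.1]
  exact t.2.2

/-- Integration from `0`, as a continuous linear operator on curves. -/
noncomputable def integrationCLM (B : Type*) [NormedAddCommGroup B] [NormedSpace ℂ B]
    [CompleteSpace B] : C(I, B) →L[ℂ] C(I, B) :=
  LinearMap.mkContinuous
    { toFun := fun γ => ⟨fun t => γ.primitive t,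
        (continuous_iff_continuousAt.2 fun t => (γ.hasDerivAt_primitive t).continuousAt).comp
          continuous_subtype_val⟩
      map_add' := by
        intro γ η
        ext t
        exact intervalIntegral.integral_add (γ.continuous.Icc_extend'.intervalIntegrable _ _)
          (η.continuous.Icc_extend'.intervalIntegrable _ _)
      map_smul' := by
        intro c γ
        ext t
        exact intervalIntegral.integral_smul c _ }
    1 (by
      intro γ
      rw [one_mul]
      exact (ContinuousMap.norm_le _ (norm_nonneg _)).2 γ.norm_primitive_le)

theorem integrationCLM_apply [CompleteSpace B] (γ : C(I, B)) (t : I) :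
    integrationCLM B γ t = γ.primitive t := rfl

end Integration

/-! ### The radial equation -/

/-- A property that holds near `0` holds at all values of a curve that is uniformly close to `0`. -/
theorem ContinuousMap.eventually_forall_apply {K : Type*} [TopologicalSpace K] [CompactSpace K]
    {P : Type*} [SeminormedAddCommGroup P] {p : P → Prop} (h : ∀ᶠ z in 𝓝 0, p z) :
    ∀ᶠ γ in 𝓝 (0 : C(K, P)), ∀ t, p (γ t) := by
  obtain ⟨ε, hε, hp⟩ := Metric.eventually_nhds_iff.1 h
  filter_upwards [Metric.ball_mem_nhds (0 : C(K, P)) hε] with γ hγ t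
  refine hp ?_
  rw [dist_zero_right]
  exact (γ.norm_coe_le_norm t).trans_lt (mem_ball_zero_iff.1 hγ)

section RadialEquation

open unitInterval

variable {A : Type*} [NormedAddCommGroup A] [NormedSpace ℂ A]
  {B : Type*} [NormedAddCommGroup B] [NormedSpace ℂ B]

/-- The linear map sending `(x, γ)` to the curve `t ↦ (x, t x, γ t)`. -/
noncomputable def radialCurve (A B : Type*) [NormedAddCommGroup A] [NormedSpace ℂ A]
    [NormedAddCommGroup B] [NormedSpace ℂ B] : A × C(I, B) →L[ℂ] C(I, A × A × B) :=
  LinearMap.mkContinuous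
    { toFun := fun c => ⟨fun t => (c.1, (t : ℝ) • c.1, c.2 t), by fun_prop⟩
      map_add' := by
        intro c d
        ext t
        · rfl
        · exact smul_add _ _ _
        · rfl
      map_smul' := by
        intro r c
        ext t
        · rfl
        · exact smul_comm _ _ _
        · rfl }
    1 (by
      intro c
      rw [one_mul]
      refine (ContinuousMap.norm_le _ (norm_nonneg _)).2 fun t => ?_
      refine max_le (norm_fst_le c) (max_le ?_ ?_)
      · refine le_trans ?_ (norm_fst_le c)
        change ‖(t : ℝ) • c.1‖ ≤ ‖c.1‖
        rw [norm_smul, Real.norm_eq_abs, abs_of_nonneg t.2.1]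
        exact mul_le_of_le_one_left (norm_nonneg _) t.2.2
      · exact (c.2.norm_coe_le_norm t).trans (norm_snd_le c))

theorem radialCurve_apply (c : A × C(I, B)) (t : I) :
    radialCurve A B c t = (c.1, (t : ℝ) • c.1, c.2 t) := rfl

/-- The radial equation `γ' t = f (t x, γ t) x`, `γ 0 = y`, is solvable on `[0, 1]` for small
`(x, y)`, with a solution depending analytically on `(x, y)`; moreover its derivatives with respect
to `x` solve the linearized equation. The solution comes from the implicit function theorem in the
Banach space of continuous curves. -/
theorem exists_analytic_radial_solution [CompleteSpace A] [CompleteSpace B]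
    {f : A × B → A →L[ℂ] B} (hf : AnalyticAt ℂ f 0) :
    ∃ Γ : A × B → C(I, B), AnalyticAt ℂ Γ 0 ∧ Γ 0 = 0 ∧ ∀ᶠ p in 𝓝 (0 : A × B),
      (∃ u : C(I, B), (∀ t, u t = f ((t : ℝ) • p.1, Γ p t) p.1) ∧
        ∀ t : I, Γ p t = p.2 + u.primitive t) ∧
      ∀ h : A, ∃ w : C(I, B),
        (∀ t, w t = fderiv ℂ f ((t : ℝ) • p.1, Γ p t) ((t : ℝ) • h, fderiv ℂ Γ p (h, 0) t) p.1 +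
          f ((t : ℝ) • p.1, Γ p t) h) ∧
        ∀ t : I, fderiv ℂ Γ p (h, 0) t = w.primitive t := by
  -- The right-hand side along `γ` is the superposition with `g` of the curve `(x, t x, γ t)`, and
  -- the solutions are the zeros of `Φ`.
  set g : A × A × B → B := fun q => f q.2 q.1 with hg
  have hg0 : AnalyticAt ℂ g 0 :=
    ((ContinuousLinearMap.analyticAt_bilinear (ContinuousLinearMap.id ℂ (A →L[ℂ] B)) _).comp₂
      (AnalyticAt.comp (f := Prod.snd) (x := (0 : A × A × B)) hf analyticAt_snd) analyticAt_fst)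
  obtain ⟨N, hN, hNev⟩ := hg0.exists_superposition (K := I)
  set L : (A × B) × C(I, B) →L[ℂ] A × C(I, B) :=
    ((ContinuousLinearMap.fst ℂ A B).comp (ContinuousLinearMap.fst ℂ _ _)).prod
      (ContinuousLinearMap.snd ℂ _ _) with hL
  set S := (radialCurve A B).comp L with hS
  set Φ : (A × B) × C(I, B) → C(I, B) := fun c =>
    c.2 - ContinuousLinearMap.const ℂ I c.1.2 - integrationCLM B (N (S c)) with hΦ
  have hNS : AnalyticAt ℂ (fun c => N (S c)) 0 :=
    AnalyticAt.comp (by simpa using hN) (S.analyticAt 0)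
  have hΦa : AnalyticAt ℂ Φ 0 :=
    (analyticAt_snd.sub ((((ContinuousLinearMap.const ℂ I : B →L[ℂ] C(I, B)).comp
      ((ContinuousLinearMap.snd ℂ A B).comp
        (ContinuousLinearMap.fst ℂ (A × B) C(I, B)))).analyticAt 0))).sub
      (((integrationCLM B).analyticAt _).comp hNS)
  have hΦc : ContDiffAt ℂ ω Φ ((0 : A × B), (0 : C(I, B))) := hΦa.contDiffAt
  have hSt : Filter.Tendsto S (𝓝 0) (𝓝 0) := by
    simpa using S.continuous.tendsto 0
  -- For `x = 0` the right-hand side of the radial equation vanishes.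
  have hΦ0 : ∀ᶠ γ in 𝓝 (0 : C(I, B)), Φ (0, γ) = γ := by
    have ht : Filter.Tendsto (fun γ : C(I, B) => S ((0 : A × B), γ)) (𝓝 0) (𝓝 0) :=
      hSt.comp (by
        have : Continuous fun γ : C(I, B) => ((0 : A × B), γ) := by fun_prop
        exact this.tendsto 0)
    filter_upwards [ht.eventually hNev] with γ hγ
    have : N (S ((0 : A × B), γ)) = 0 := by
      ext t
      rw [hγ.1]
      simp [hg, hS, hL, radialCurve_apply]
    simp [hΦ, this]
  -- So the partial derivative of `Φ` with respect to the curve is the identity.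
  have hinr : fderiv ℂ Φ ((0 : A × B), (0 : C(I, B))) ∘L
      ContinuousLinearMap.inr ℂ (A × B) C(I, B) = ContinuousLinearMap.id ℂ _ := by
    have h1 : HasFDerivAt (fun γ : C(I, B) => Φ (0, γ))
        (fderiv ℂ Φ ((0 : A × B), (0 : C(I, B))) ∘L
          ContinuousLinearMap.inr ℂ (A × B) C(I, B)) 0 :=
      HasFDerivAt.comp (g := Φ) 0 hΦa.differentiableAt.hasFDerivAt
        (hasFDerivAt_prodMk_right (0 : A × B) (0 : C(I, B)))
    exact h1.unique ((hasFDerivAt_id _).congr_of_eventuallyEq hΦ0)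
  have hinv : (fderiv ℂ Φ ((0 : A × B), (0 : C(I, B))) ∘L
      ContinuousLinearMap.inr ℂ (A × B) C(I, B)).IsInvertible := by
    rw [hinr]
    exact ⟨ContinuousLinearEquiv.refl ℂ _, rfl⟩
  have hω : (ω : WithTop ℕ∞) ≠ 0 := by simp
  set Γ := hΦc.implicitFunction hω hinv with hΓ
  have hΓ0 : Γ 0 = 0 := hΦc.implicitFunction_apply_self hω hinv
  have hΓa : AnalyticAt ℂ Γ 0 := (hΦc.contDiffAt_implicitFunction hω hinv).analyticAt
  have hΓe : ∀ᶠ p in 𝓝 (0 : A × B),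
      Γ p = ContinuousLinearMap.const ℂ I p.2 + integrationCLM B (N (S (p, Γ p))) := by
    filter_upwards [hΦc.eventually_apply_implicitFunction hω hinv] with p hp
    rw [hΦ0.self_of_nhds] at hp
    rw [← sub_eq_zero, ← sub_sub]
    exact hp
  have hpair : Filter.Tendsto (fun p => (p, Γ p)) (𝓝 (0 : A × B)) (𝓝 0) := by
    have := (continuousAt_id (x := (0 : A × B))).prodMk hΓa.continuousAt
    rw [ContinuousAt, id, hΓ0] at this
    exact this
  have hpairS := hSt.comp hpair
  have hfs : ∀ᶠ q in 𝓝 (0 : A × A × B), AnalyticAt ℂ f q.2 :=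
    (continuous_snd.tendsto' (0 : A × A × B) 0 rfl).eventually hf.eventually_analyticAt
  refine ⟨Γ, hΓa, hΓ0, ?_⟩
  filter_upwards [hΓe.eventually_nhds, hpairS.eventually hNev,
    hpairS.eventually hN.eventually_analyticAt, hΓa.eventually_analyticAt,
    hpairS.eventually (ContinuousMap.eventually_forall_apply hfs)]
    with p hΓp hNp hNa hΓpa hfp
  have hcurve : ∀ t, S (p, Γ p) t = (p.1, (t : ℝ) • p.1, Γ p t) := fun t => rfl
  refine ⟨⟨N (S (p, Γ p)), fun t => (hNp.1 t).trans rfl, fun t => ?_⟩, fun h => ?_⟩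
  · conv_lhs => rw [hΓp.self_of_nhds]
    rfl
  · set δ := fderiv ℂ Γ p (h, 0) with hδ
    refine ⟨fderiv ℂ N (S (p, Γ p)) (S ((h, 0), δ)), fun t => ?_, fun t => ?_⟩
    · rw [Function.comp_apply] at hNp
      rw [hNp.2, hcurve]
      have hfd : HasFDerivAt f (fderiv ℂ f ((t : ℝ) • p.1, Γ p t)) ((t : ℝ) • p.1, Γ p t) :=
        (hfp t).differentiableAt.hasFDerivAt
      have hfd' : HasFDerivAt (fun q : A × A × B => f q.2)
          ((fderiv ℂ f ((t : ℝ) • p.1, Γ p t)).comp (ContinuousLinearMap.snd ℂ A (A × B)))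
          (p.1, (t : ℝ) • p.1, Γ p t) :=
        HasFDerivAt.comp (g := f) (p.1, (t : ℝ) • p.1, Γ p t) hfd hasFDerivAt_snd
      have hgd := hfd'.clm_apply (hasFDerivAt_fst (𝕜 := ℂ) (p := (p.1, (t : ℝ) • p.1, Γ p t)))
      rw [hg, hgd.fderiv]
      exact add_comm _ _
    · have hpd : HasFDerivAt (fun q => (q, Γ q))
          ((ContinuousLinearMap.id ℂ _).prod (fderiv ℂ Γ p)) p :=
        (hasFDerivAt_id p).prodMk hΓpa.differentiableAt.hasFDerivAt
      have hNd : HasFDerivAt (fun q => N (S (q, Γ q))) ((fderiv ℂ N (S (p, Γ p))).comp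
          (S.comp ((ContinuousLinearMap.id ℂ _).prod (fderiv ℂ Γ p)))) p :=
        HasFDerivAt.comp (g := N) p hNa.differentiableAt.hasFDerivAt
          (S.hasFDerivAt.comp p hpd)
      have hrhs := ((ContinuousLinearMap.const ℂ I : B →L[ℂ] C(I, B)).hasFDerivAt.comp p
        (hasFDerivAt_snd (𝕜 := ℂ) (p := p))).add ((integrationCLM B).hasFDerivAt.comp p hNd)
      have heq := (hΓpa.differentiableAt.hasFDerivAt).unique (hrhs.congr_of_eventuallyEq hΓp)
      have := congrArg (fun l : A × B →L[ℂ] C(I, B) => l (h, 0) t) heq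
      refine this.trans ?_
      simp [integrationCLM_apply, hδ]

end RadialEquation

/-! ### Leaves of an integrable family of graphs -/

section Leaves

open unitInterval

variable {A : Type*} [NormedAddCommGroup A] [NormedSpace ℂ A]
  {B : Type*} [NormedAddCommGroup B] [NormedSpace ℂ B]

/-- If `f` satisfies the Frobenius integrability condition along a radial solution `q`, then the
solution `δ` of the linearized equation in the direction `h` is `t ↦ t f (t x, q t) h`: the
difference of the two curves solves a homogeneous linear equation and vanishes at `0`. -/
theorem linearized_radial_solution_eq [CompleteSpace B] {f : A × B → A →L[ℂ] B} {x h : A} {y : B}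
    {q u δ w : C(I, B)} {C : ℝ}
    (hfd : ∀ t : I, DifferentiableAt ℂ f ((t : ℝ) • x, q t))
    (hC : ∀ t : I, ‖fderiv ℂ f ((t : ℝ) • x, q t)‖ ≤ C)
    (hsymm : ∀ t : I, fderiv ℂ f ((t : ℝ) • x, q t) (x, f ((t : ℝ) • x, q t) x) h =
      fderiv ℂ f ((t : ℝ) • x, q t) (h, f ((t : ℝ) • x, q t) h) x)
    (hu : ∀ t : I, u t = f ((t : ℝ) • x, q t) x) (hq : ∀ t : I, q t = y + u.primitive t)
    (hw : ∀ t : I, w t = fderiv ℂ f ((t : ℝ) • x, q t) ((t : ℝ) • h, δ t) x +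
      f ((t : ℝ) • x, q t) h)
    (hδ : ∀ t : I, δ t = w.primitive t) (t : I) :
    δ t = (t : ℝ) • f ((t : ℝ) • x, q t) h := by
  set z : ℝ → A × B := fun τ => (τ • x, y + u.primitive τ) with hz
  have hzI : ∀ t : I, z t = ((t : ℝ) • x, q t) := fun t => by rw [hz, hq]
  -- `k` is the difference of the two curves; the symmetry of `Df` makes its derivative `k'` linear
  -- in `k`.
  set k : ℝ → B := fun τ => w.primitive τ - τ • f (z τ) h with hk
  set k' : ℝ → B := fun τ => fderiv ℂ f (z τ) (0, k τ) x with hk'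
  have hderiv : ∀ τ ∈ Set.Icc (0 : ℝ) 1, HasDerivAt k (k' τ) τ := by
    intro τ hτ
    have hzτ : z τ = (τ • x, q ⟨τ, hτ⟩) := hzI ⟨τ, hτ⟩
    have hzd : HasDerivAt z (x, f (z τ) x) τ := by
      have h1 : HasDerivAt (fun τ : ℝ => τ • x) ((1 : ℝ) • x) τ := (hasDerivAt_id τ).smul_const x
      have h2 := (u.hasDerivAt_primitive τ).const_add y
      rw [Set.IccExtend_of_mem _ _ hτ, hu, ← hzτ] at h2
      rw [one_smul] at h1
      exact h1.prodMk h2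
    have hfz : HasFDerivAt f (fderiv ℂ f (z τ)) (z τ) := by
      rw [hzτ]
      exact (hfd ⟨τ, hτ⟩).hasFDerivAt
    have hfzd : HasDerivAt (fun τ => f (z τ)) (fderiv ℂ f (z τ) (x, f (z τ) x)) τ :=
      (hfz.restrictScalars ℝ).comp_hasDerivAt τ hzd
    have hfzh : HasDerivAt (fun τ => f (z τ) h) (fderiv ℂ f (z τ) (x, f (z τ) x) h) τ :=
      (((ContinuousLinearMap.apply ℂ B h).restrictScalars ℝ).hasFDerivAt.comp_hasDerivAt τ hfzd)
    have hs := (w.hasDerivAt_primitive τ).sub ((hasDerivAt_id τ).smul hfzh)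
    refine hs.congr_deriv ?_
    have hsym := hsymm ⟨τ, hτ⟩
    rw [← hzI] at hsym
    have hδτ := hδ ⟨τ, hτ⟩
    rw [Set.IccExtend_of_mem _ _ hτ, hw, ← hzI, hδτ, hk']
    simp only [id, one_smul, hk]
    rw [show fderiv ℂ f (z τ) (x, f (z τ) x) h = _ from hsym]
    have hsplit : ((0 : A), w.primitive τ - τ • f (z τ) h) =
        (τ • h, w.primitive τ) - τ • (h, f (z τ) h) := by
      ext <;> simp
    rw [hsplit, map_sub, sub_apply,
      ← Complex.coe_smul τ ((h, f (z τ) h) : A × B), map_smul, smul_apply,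
      Complex.coe_smul]
    abel
  have h0 : k 0 = 0 := by simp [hk, ContinuousMap.primitive]
  have hbound : ∀ τ ∈ Set.Ico (0 : ℝ) 1, ‖k' τ‖ ≤ C * ‖x‖ * ‖k τ‖ := by
    intro τ hτ
    have hCτ := hC ⟨τ, Set.Ico_subset_Icc_self hτ⟩
    rw [← hzI] at hCτ
    calc ‖k' τ‖ ≤ ‖fderiv ℂ f (z τ) (0, k τ)‖ * ‖x‖ := ContinuousLinearMap.le_opNorm _ _
      _ ≤ (C * ‖((0 : A), k τ)‖) * ‖x‖ := by
        gcongr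
        exact (ContinuousLinearMap.le_opNorm _ _).trans (by gcongr)
      _ = C * ‖x‖ * ‖k τ‖ := by
        rw [show ‖((0 : A), k τ)‖ = ‖k τ‖ by simp [Prod.norm_def]]
        ring
  have hzero := eq_zero_of_abs_deriv_le_mul_abs_self_of_eq_zero_right
    (fun τ hτ => (hderiv τ hτ).continuousAt.continuousWithinAt)
    (fun τ hτ => (hderiv τ (Set.Ico_subset_Icc_self hτ)).hasDerivWithinAt) h0 hbound t t.2
  rw [hδ, ← hzI]
  exact sub_eq_zero.1 hzero

/-- The leaves of an integrable family of graphs: the graph of `x ↦ α (x, y)` is the leaf through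
`(0, y)`. The value `α (x, y)` is the endpoint of the radial solution. -/
theorem exists_analytic_leaves [CompleteSpace A] [CompleteSpace B] {f : A × B → A →L[ℂ] B}
    (hf : AnalyticAt ℂ f 0)
    (hsymm : ∀ᶠ z in 𝓝 0, ∀ h k, fderiv ℂ f z (h, f z h) k = fderiv ℂ f z (k, f z k) h) :
    ∃ α : A × B → B, AnalyticAt ℂ α 0 ∧ α 0 = 0 ∧ (∀ k, fderiv ℂ α 0 (0, k) = k) ∧
      ∀ᶠ p in 𝓝 (0 : A × B), ∀ h, fderiv ℂ α p (h, 0) = f (p.1, α p) h := by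
  obtain ⟨Γ, hΓ, hΓ0, hev⟩ := exists_analytic_radial_solution hf
  set ev : C(I, B) →L[ℂ] B := ContinuousMap.evalCLM ℂ (1 : I) with hevd
  have hα : AnalyticAt ℂ (fun p => ev (Γ p)) 0 := (ev.analyticAt _).comp hΓ
  refine ⟨fun p => ev (Γ p), hα, by simp [hΓ0], fun k => ?_, ?_⟩
  · have hy : ∀ᶠ y in 𝓝 (0 : B), ev (Γ (0, y)) = y := by
      have ht : Filter.Tendsto (fun y : B => ((0 : A), y)) (𝓝 0) (𝓝 0) :=
        Continuous.tendsto' (by fun_prop) _ _ rfl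
      filter_upwards [ht.eventually hev] with y hy
      obtain ⟨⟨u, hu, hq⟩, -⟩ := hy
      have hu0 : u = 0 := by
        ext t
        simp [hu]
      rw [hevd, ContinuousMap.evalCLM_apply, hq, hu0]
      simp [ContinuousMap.primitive, Set.IccExtend]
    have h1 : HasFDerivAt (fun y : B => ev (Γ ((0 : A), y)))
        ((fderiv ℂ (fun p => ev (Γ p)) ((0 : A), (0 : B))).comp
          (ContinuousLinearMap.inr ℂ A B)) 0 :=
      HasFDerivAt.comp (g := fun p => ev (Γ p)) 0 hα.differentiableAt.hasFDerivAt
        (hasFDerivAt_prodMk_right (0 : A) (0 : B))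
    exact congrArg (fun l : B →L[ℂ] B => l k)
      (h1.unique ((hasFDerivAt_id _).congr_of_eventuallyEq hy))
  · have hbd : ∀ᶠ z in 𝓝 (0 : A × B), ‖fderiv ℂ f z‖ < ‖fderiv ℂ f 0‖ + 1 :=
      (hf.fderiv.continuousAt.norm).eventually (gt_mem_nhds (lt_add_one _))
    have hgood := ContinuousMap.eventually_forall_apply (K := I)
      (hsymm.and (hf.eventually_analyticAt.and hbd))
    have ht : Filter.Tendsto
        (fun p => (ContinuousLinearMap.snd ℂ A (A × B)).compLeftContinuous ℂ I
          (radialCurve A B (p.1, Γ p))) (𝓝 0) (𝓝 0) := by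
      have hc : ContinuousAt (fun p => (ContinuousLinearMap.snd ℂ A (A × B)).compLeftContinuous ℂ I
          (radialCurve A B (p.1, Γ p))) 0 :=
        ((((ContinuousLinearMap.snd ℂ A (A × B)).compLeftContinuous ℂ I).continuous.comp
          (radialCurve A B).continuous).continuousAt).comp
            (continuousAt_fst.prodMk hΓ.continuousAt)
      rw [ContinuousAt, hΓ0, show ((0 : A × B).1, (0 : C(I, B))) = 0 from rfl, map_zero,
        map_zero] at hc
      exact hc
    filter_upwards [hev, ht.eventually hgood, hΓ.eventually_analyticAt] with p hp hpg hpa h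
    obtain ⟨⟨u, hu, hq⟩, hlin⟩ := hp
    obtain ⟨w, hw, hδ⟩ := hlin h
    have hfin := linearized_radial_solution_eq (fun t => (hpg t).2.1.differentiableAt)
      (fun t => (hpg t).2.2.le) (fun t => (hpg t).1 p.1 h) hu hq hw hδ 1
    have hchain : fderiv ℂ (fun p => ev (Γ p)) p = ev.comp (fderiv ℂ Γ p) :=
      (ev.hasFDerivAt.comp p hpa.differentiableAt.hasFDerivAt).fderiv
    rw [hchain]
    rw [Set.Icc.coe_one, one_smul, one_smul] at hfin
    exact hfin

end Leaves

/-! ### Straightening a family of graphs -/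

section Straightening

variable {A : Type*} [NormedAddCommGroup A] [NormedSpace ℂ A] [CompleteSpace A]
  {B : Type*} [NormedAddCommGroup B] [NormedSpace ℂ B] [CompleteSpace B]

/-- The local inverse, near a point with invertible derivative, of an analytic map: it can be chosen
analytic, and such that its source consists of points where a given local property holds. -/
theorem exists_analytic_local_inverse {E : Type*} [NormedAddCommGroup E] [NormedSpace ℂ E]
    [CompleteSpace E] {Ψ : E → E} {a : E} (hΨ : AnalyticAt ℂ Ψ a)
    (hinv : (fderiv ℂ Ψ a).IsInvertible) {p : E → Prop} (hp : ∀ᶠ x in 𝓝 a, p x) :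
    ∃ e : OpenPartialHomeomorph E E, a ∈ e.source ∧ (∀ x, e x = Ψ x) ∧
      (∀ x ∈ e.source, p x ∧ AnalyticAt ℂ Ψ x ∧ (fderiv ℂ Ψ x).IsInvertible) ∧
      ContDiffOn ℂ ω e e.source ∧ ContDiffOn ℂ ω e.symm e.target := by
  obtain ⟨Ψ', hΨ'⟩ := hinv
  have hstrict : HasStrictFDerivAt Ψ (Ψ' : E →L[ℂ] E) a := hΨ' ▸ hΨ.hasStrictFDerivAt
  have hgood : ∀ᶠ x in 𝓝 a, p x ∧ AnalyticAt ℂ Ψ x ∧ (fderiv ℂ Ψ x).IsInvertible := by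
    refine hp.and (hΨ.eventually_analyticAt.and ?_)
    have := hΨ.fderiv.continuousAt.eventually (hΨ' ▸ Ψ'.nhds)
    filter_upwards [this] with x hx using hx
  obtain ⟨s, hs, hso, has⟩ := eventually_nhds_iff.1 hgood
  refine ⟨(hstrict.toOpenPartialHomeomorph Ψ).restrOpen s hso,
    ⟨hstrict.mem_toOpenPartialHomeomorph_source, has⟩, fun x => rfl, fun x hx => hs x hx.2,
    fun x hx => ?_, fun y hy => ?_⟩
  · exact ((hs x hx.2).2.1.contDiffAt (n := ω)).contDiffWithinAt
  · set e := (hstrict.toOpenPartialHomeomorph Ψ).restrOpen s hso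
    have hx := e.map_target hy
    obtain ⟨-, ha, ⟨L, hL⟩⟩ := hs _ hx.2
    refine (e.contDiffAt_symm (f₀' := L) hy ?_ ha.contDiffAt).contDiffWithinAt
    rw [hL]
    exact ha.differentiableAt.hasFDerivAt

/-- An integrable family of graphs is straightened by a local analytic isomorphism: near `0`, the
vectors of the graph of `f z` are those which the differential of `Θ` makes horizontal. The map `Θ`
is the inverse of `(x, y) ↦ (x, α (x, y))`, where `α (·, y)` is the leaf through `(0, y)`. -/
theorem exists_straightening {f : A × B → A →L[ℂ] B} (hf : AnalyticAt ℂ f 0)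
    (hsymm : ∀ᶠ z in 𝓝 0, ∀ h k, fderiv ℂ f z (h, f z h) k = fderiv ℂ f z (k, f z k) h) :
    ∃ Θ : OpenPartialHomeomorph (A × B) (A × B), 0 ∈ Θ.source ∧
      ContDiffOn ℂ ω Θ Θ.source ∧ ContDiffOn ℂ ω Θ.symm Θ.target ∧
      ∀ z ∈ Θ.source, ∀ v : A × B, (fderiv ℂ Θ z v).2 = 0 ↔ v.2 = f z v.1 := by
  obtain ⟨α, hα, hα0, hα2, hα1⟩ := exists_analytic_leaves hf hsymm
  set Ψ : A × B → A × B := fun p => (p.1, α p) with hΨ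
  have hΨd : ∀ p, AnalyticAt ℂ α p → ∀ v, fderiv ℂ Ψ p v = (v.1, fderiv ℂ α p v) := by
    intro p hp v
    rw [(hasFDerivAt_fst.prodMk hp.differentiableAt.hasFDerivAt : HasFDerivAt Ψ _ p).fderiv]
    rfl
  have hΨa : AnalyticAt ℂ Ψ 0 := analyticAt_fst.prod hα
  have hsplit : ∀ p, ∀ v : A × B,
      fderiv ℂ α p v = fderiv ℂ α p (v.1, 0) + fderiv ℂ α p (0, v.2) := by
    intro p v
    rw [← map_add]
    simp
  have hinv : (fderiv ℂ Ψ 0).IsInvertible := by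
    refine ⟨ContinuousLinearEquiv.skewProd (ContinuousLinearEquiv.refl ℂ A)
      (ContinuousLinearEquiv.refl ℂ B) ((fderiv ℂ α 0).comp (ContinuousLinearMap.inl ℂ A B)), ?_⟩
    refine ContinuousLinearMap.ext fun v => ?_
    rw [hΨd 0 hα, hsplit, hα2]
    exact Prod.ext rfl (add_comm _ _)
  obtain ⟨e, he0, heΨ, hes, hea, hea'⟩ := exists_analytic_local_inverse hΨa hinv
    (hα1.and hα.eventually_analyticAt)
  have hΨ0 : Ψ 0 = 0 := by simp [hΨ, hα0]
  refine ⟨e.symm, ?_, hea', by simpa using hea, fun z hz v => ?_⟩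
  · have := e.map_source he0
    rwa [heΨ, hΨ0] at this
  · set p := e.symm z with hp
    have hpz : Ψ p = z := (heΨ p).symm.trans (e.right_inv hz)
    obtain ⟨⟨h1, hαp⟩, hΨp, ⟨L, hL⟩⟩ := hes p (e.map_target hz)
    have hd : fderiv ℂ e.symm z = (L.symm : A × B →L[ℂ] A × B) := by
      refine (e.hasFDerivAt_symm hz ?_).fderiv
      rw [hL, show (e : A × B → A × B) = Ψ from funext heΨ]
      exact hΨp.differentiableAt.hasFDerivAt
    have hLw : ∀ w, L w = (w.1, fderiv ℂ α p w) := fun w => by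
      rw [← hΨd p hαp, ← hL]
      rfl
    have hfz : ∀ h, fderiv ℂ α p (h, 0) = f z h := fun h => by rw [h1, ← hpz]
    rw [hd, ContinuousLinearEquiv.coe_coe]
    constructor
    · intro hv
      have h2 := hLw (L.symm v)
      rw [L.apply_symm_apply, show L.symm v = ((L.symm v).1, 0) from Prod.ext rfl hv, hfz] at h2
      rw [h2]
    · intro hv
      have h2 : L (v.1, 0) = v := by
        rw [hLw, hfz, ← hv]
      rw [← h2, L.symm_apply_apply]

end Straightening

/-! ### Involutive subbundles in a Banach space -/

section BanachSpace

variable {X : Type*} [NormedAddCommGroup X] [NormedSpace ℂ X] [CompleteSpace X]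

/-- A closed complemented subspace is a factor of a splitting of the ambient Banach space into a
product of Banach spaces. -/
theorem Submodule.ClosedComplemented.exists_banach_splitting {K : Submodule ℂ X}
    (hK : K.ClosedComplemented) :
    ∃ (K' : Submodule ℂ X) (_ : CompleteSpace K) (_ : CompleteSpace K') (ι : X ≃L[ℂ] K × K'),
      ∀ v, v ∈ K ↔ (ι v).2 = 0 := by
  obtain ⟨K', ι, h1, h2, h3⟩ := hK.exists_submodule_equiv_prod
  have hsum : ∀ v, v = ((ι v).1 : X) + (ι v).2 := fun v => by rw [← h3, ι.symm_apply_apply]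
  have hmem : ∀ v, v ∈ K ↔ (ι v).2 = 0 := fun v => by
    refine ⟨fun hv => by rw [h1 ⟨v, hv⟩], fun hv => ?_⟩
    rw [hsum v, hv]
    simp
  have hmem' : ∀ v, v ∈ K' ↔ (ι v).1 = 0 := fun v => by
    refine ⟨fun hv => by rw [h2 ⟨v, hv⟩], fun hv => ?_⟩
    rw [hsum v, hv]
    simp
  have hcK : IsClosed (K : Set X) := hK.isClosed
  have hcK' : IsClosed (K' : Set X) := by
    have : (K' : Set X) = (fun v => (ι v).1) ⁻¹' {0} := Set.ext hmem'
    rw [this]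
    exact isClosed_singleton.preimage (by fun_prop)
  exact ⟨K', hcK.completeSpace_coe, hcK'.completeSpace_coe, ι, hmem⟩

/-- Near a point where the second partial map of `R` is the identity, the kernels of an analytic
family `R` of operators form an analytic family of graphs. -/
theorem exists_graph_of_kernel {Z A B : Type*} [NormedAddCommGroup Z] [NormedSpace ℂ Z]
    [NormedAddCommGroup A] [NormedSpace ℂ A] [NormedAddCommGroup B] [NormedSpace ℂ B]
    [CompleteSpace B] {R : Z → A × B →L[ℂ] B} {z : Z} (hR : AnalyticAt ℂ R z)
    (hRz : R z = ContinuousLinearMap.snd ℂ A B) :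
    ∃ f : Z → A →L[ℂ] B, AnalyticAt ℂ f z ∧ ∀ᶠ w in 𝓝 z, ∀ v, R w v = 0 ↔ v.2 = f w v.1 := by
  set S : Z → B →L[ℂ] B := fun w => (R w).comp (ContinuousLinearMap.inr ℂ A B) with hS
  have hSa : ContDiffAt ℂ ω S z := hR.contDiffAt.clm_comp contDiffAt_const
  have hSz : S z = (ContinuousLinearEquiv.refl ℂ B : B →L[ℂ] B) := by
    rw [hS]
    simp only [hRz]
    rfl
  have hinv : ContDiffAt ℂ ω (fun w => ContinuousLinearMap.inverse (S w)) z := by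
    refine ContDiffAt.comp (g := ContinuousLinearMap.inverse) z ?_ hSa
    rw [hSz]
    exact contDiffAt_map_inverse _
  refine ⟨fun w => -((ContinuousLinearMap.inverse (S w)).comp
    ((R w).comp (ContinuousLinearMap.inl ℂ A B))),
    (hinv.clm_comp (hR.contDiffAt.clm_comp contDiffAt_const)).neg.analyticAt, ?_⟩
  have hnhds := hSa.continuousAt.eventually (hSz ▸ ContinuousLinearEquiv.nhds _)
  filter_upwards [hnhds] with w hw v
  obtain ⟨L, hL⟩ := hw
  have hsplit : R w v = R w (v.1, 0) + L v.2 := by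
    have : L v.2 = R w (0, v.2) := congrArg (fun l : B →L[ℂ] B => l v.2) hL
    rw [this, ← map_add]
    simp
  rw [hsplit, ← hL, ContinuousLinearMap.inverse_equiv]
  change _ ↔ v.2 = -(L.symm (R w (v.1, 0)))
  rw [← map_neg, L.eq_symm_apply, eq_neg_iff_add_eq_zero, add_comm]

/-- The Frobenius theorem in a Banach space, for the subbundle of the vectors `v` at `x` such that
`T x v ∈ K`: if brackets of its sections are sections, then a local analytic isomorphism maps it to
the constant subbundle `K`. -/
theorem exists_straightening_of_involutive {T : X → X →L[ℂ] X} {K : Submodule ℂ X}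
    (hK : K.ClosedComplemented) {x₀ : X} (hT : AnalyticAt ℂ T x₀) (hT₀ : (T x₀).IsInvertible)
    {O : Set X} (hO : O ∈ 𝓝 x₀)
    (hinv : ∀ V : Set X, IsOpen V → V ⊆ O → ∀ ξ η : X → X,
      ContDiffOn ℂ ω ξ V → ContDiffOn ℂ ω η V → (∀ x ∈ V, T x (ξ x) ∈ K) →
      (∀ x ∈ V, T x (η x) ∈ K) → ∀ x ∈ V, T x (VectorField.lieBracket ℂ ξ η x) ∈ K) :
    ∃ Θ : OpenPartialHomeomorph X X, x₀ ∈ Θ.source ∧ Θ.source ⊆ O ∧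
      ContDiffOn ℂ ω Θ Θ.source ∧ ContDiffOn ℂ ω Θ.symm Θ.target ∧
      ∀ x ∈ Θ.source, ∀ v, T x v ∈ K ↔ fderiv ℂ Θ x v ∈ K := by
  obtain ⟨K', _, _, ι, hι⟩ := hK.exists_banach_splitting
  -- The coordinates `c`, with differential `j`, are chosen such that the subbundle is the graph of
  -- `0` at the origin.
  obtain ⟨T₀, hT₀⟩ := hT₀
  set j : X ≃L[ℂ] K × K' := T₀.trans ι with hj
  set c : X ≃ₜ K × K' := (Homeomorph.subRight x₀).trans j.toHomeomorph with hc
  have hcx : ∀ x, c x = j (x - x₀) := fun x => rfl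
  have hcx₀ : c x₀ = 0 := by rw [hcx, sub_self, map_zero]
  have hc0 : c.symm 0 = x₀ := by rw [← hcx₀, c.symm_apply_apply]
  have hcd : ∀ x, HasFDerivAt c (j : X →L[ℂ] K × K') x := fun x =>
    (j : X →L[ℂ] K × K').hasFDerivAt.comp x ((hasFDerivAt_id x).sub_const x₀)
  have hcω : ContDiff ℂ ω c := j.contDiff.comp (contDiff_id.sub contDiff_const)
  have hcω' : ContDiff ℂ ω c.symm := j.symm.contDiff.add contDiff_const
  set R : K × K' → K × K' →L[ℂ] K' := fun z =>
    ((ContinuousLinearMap.snd ℂ K K').comp (ι : X →L[ℂ] K × K')).comp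
      ((T (c.symm z)).comp (j.symm : K × K' →L[ℂ] X)) with hR
  have hRa : AnalyticAt ℂ R 0 := by
    have h1 : ContDiffAt ℂ ω (fun z => T (c.symm z)) 0 :=
      ContDiffAt.comp (g := T) 0 (hc0.symm ▸ hT.contDiffAt) hcω'.contDiffAt
    exact (contDiffAt_const.clm_comp (h1.clm_comp contDiffAt_const)).analyticAt
  have hR0 : R 0 = ContinuousLinearMap.snd ℂ K K' := by
    refine ContinuousLinearMap.ext fun v => ?_
    change (ι (T (c.symm 0) (j.symm v))).2 = v.2
    rw [hc0, ← hT₀]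
    change (j (j.symm v)).2 = v.2
    rw [j.apply_symm_apply]
  have hRK : ∀ x v, T x v ∈ K ↔ R (c x) (j v) = 0 := fun x v => by
    rw [hι]
    change _ ↔ (ι (T (c.symm (c x)) (j.symm (j v)))).2 = 0
    rw [c.symm_apply_apply, j.symm_apply_apply]
  obtain ⟨f, hf, hker⟩ := exists_graph_of_kernel hRa hR0
  have hO' : ∀ᶠ z in 𝓝 (0 : K × K'), c.symm z ∈ O :=
    c.symm.continuous.continuousAt.eventually (hc0.symm ▸ hO)
  obtain ⟨W, hW, hWo, h0W⟩ := eventually_nhds_iff.1 (hker.and (hf.eventually_analyticAt.and hO'))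
  have hVo : IsOpen (c ⁻¹' W) := hWo.preimage c.continuous
  have hVO : c ⁻¹' W ⊆ O := fun x hx => by simpa using (hW _ hx).2.2
  have hmemK : ∀ x ∈ c ⁻¹' W, ∀ v, T x v ∈ K ↔ (j v).2 = f (c x) (j v).1 := fun x hx v =>
    (hRK x v).trans ((hW _ hx).1 _)
  -- The sections of the subbundle whose first component is a constant `h`; the bracket of two of
  -- them has first component `0`, so that it lies in the subbundle only if it vanishes.
  set ξ : K → X → X := fun h x => j.symm (h, f (c x) h) with hξ
  have hfc : ∀ x ∈ c ⁻¹' W, ContDiffAt ℂ ω (fun x => f (c x)) x := fun x hx =>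
    ContDiffAt.comp (g := f) x (hW _ hx).2.1.contDiffAt hcω.contDiffAt
  have hξω : ∀ h, ContDiffOn ℂ ω (ξ h) (c ⁻¹' W) := fun h x hx =>
    (j.symm.contDiff.contDiffAt.comp x
      (contDiffAt_const.prodMk ((hfc x hx).clm_apply contDiffAt_const))).contDiffWithinAt
  have hξd : ∀ h, ∀ x ∈ c ⁻¹' W, ∀ v,
      fderiv ℂ (ξ h) x v = j.symm (0, fderiv ℂ f (c x) (j v) h) := by
    intro h x hx v
    have h1 : HasFDerivAt (fun x => f (c x)) ((fderiv ℂ f (c x)).comp (j : X →L[ℂ] K × K')) x :=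
      HasFDerivAt.comp (g := f) x (hW _ hx).2.1.differentiableAt.hasFDerivAt (hcd x)
    have h2 : HasFDerivAt (fun x => f (c x) h) _ x :=
      (ContinuousLinearMap.apply ℂ K' h).hasFDerivAt.comp x h1
    have h3 : HasFDerivAt (ξ h) _ x := (j.symm : K × K' →L[ℂ] X).hasFDerivAt.comp x
      ((hasFDerivAt_const h x).prodMk h2)
    rw [h3.fderiv]
    rfl
  have hξK : ∀ h, ∀ x ∈ c ⁻¹' W, T x (ξ h x) ∈ K := fun h x hx => by
    rw [hmemK x hx, j.apply_symm_apply]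
  have hsymm : ∀ᶠ z in 𝓝 (0 : K × K'), ∀ h k,
      fderiv ℂ f z (h, f z h) k = fderiv ℂ f z (k, f z k) h := by
    filter_upwards [hWo.mem_nhds h0W] with z hz h k
    obtain ⟨x, rfl⟩ := c.surjective z
    have hbr := hinv _ hVo hVO (ξ h) (ξ k) (hξω h) (hξω k) (hξK h) (hξK k) x hz
    rw [hmemK x hz] at hbr
    simp only [VectorField.lieBracket_eq] at hbr
    rw [hξd k x hz, hξd h x hz, ← map_sub,
      j.apply_symm_apply, j.apply_symm_apply, j.apply_symm_apply] at hbr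
    simpa [sub_eq_zero] using hbr
  obtain ⟨Θ, hΘ0, hΘ, hΘ', hΘf⟩ := exists_straightening hf hsymm
  set Θ₁ := Θ.restrOpen W hWo
  refine ⟨(c.transOpenPartialHomeomorph Θ₁).transHomeomorph ι.symm.toHomeomorph, ?_, ?_, ?_, ?_, ?_⟩
  · change c x₀ ∈ Θ.source ∩ W
    rw [hcx₀]
    exact ⟨hΘ0, h0W⟩
  · exact fun x hx => hVO hx.2
  · exact ι.symm.contDiff.comp_contDiffOn (hΘ.comp hcω.contDiffOn fun x hx => hx.1)
  · exact hcω'.comp_contDiffOn (hΘ'.comp ι.contDiff.contDiffOn fun x hx => hx.1)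
  · intro x hx v
    have hd : HasFDerivAt (fun x => ι.symm (Θ (c x))) _ x :=
      (ι.symm : K × K' →L[ℂ] X).hasFDerivAt.comp x (HasFDerivAt.comp (g := Θ) x
        ((hΘ.contDiffAt (Θ.open_source.mem_nhds hx.1)).differentiableAt (by simp)).hasFDerivAt
        (hcd x))
    change _ ↔ fderiv ℂ (fun x => ι.symm (Θ (c x))) x v ∈ K
    rw [hd.fderiv, hmemK x hx.2, ← hΘf (c x) hx.1, hι]
    change _ ↔ (ι (ι.symm (fderiv ℂ Θ (c x) (j v)))).2 = 0
    rw [ι.apply_symm_apply]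

end BanachSpace

/-! ### Flat charts on a manifold -/

section Manifold

variable {X : Type u} [NormedAddCommGroup X] [NormedSpace ℂ X]
  {M : Type v} [TopologicalSpace M] [ChartedSpace X M] [IsManifold 𝓘(ℂ, X) ω M]

theorem VectorField.mlieBracket_eq_lieBracket {V W : ∀ x : X, TangentSpace 𝓘(ℂ, X) x} :
    VectorField.mlieBracket 𝓘(ℂ, X) V W = VectorField.lieBracket ℂ V W := by
  rw [← VectorField.mlieBracketWithin_univ, VectorField.mlieBracketWithin_eq_lieBracketWithin]
  exact VectorField.lieBracketWithin_univ

/-- The identification of `X × X` with the tangent bundle of `X` is analytic; here `X × X` is a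
vector space, not a product of two manifolds. -/
theorem contMDiff_tangentBundle_mk : ContMDiff 𝓘(ℂ, X × X) 𝓘(ℂ, X).tangent ω
    (fun q : X × X => (⟨q.1, q.2⟩ : TangentBundle 𝓘(ℂ, X) X)) := by
  intro q
  refine Bundle.contMDiffAt_totalSpace.2 ⟨contDiff_fst.contMDiff.contMDiffAt, ?_⟩
  simpa using contDiff_snd.contMDiff.contMDiffAt

/-- In the chart at `m`, a holomorphic subbundle consists of the vectors that an operator `T x`,
depending analytically on the base point `x`, maps into a fixed complemented subspace `K`. -/
theorem IsHolomorphicSubbundle.exists_coordinates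
    {E : ∀ p : M, Submodule ℂ (TangentSpace 𝓘(ℂ, X) p)} (hE : IsHolomorphicSubbundle E) (m : M) :
    ∃ (T : X → X →L[ℂ] X) (K : Submodule ℂ X) (O : Set X),
      K.ClosedComplemented ∧ O ∈ 𝓝 (chartAt X m m) ∧ ContDiffAt ℂ ω T (chartAt X m m) ∧
      (T (chartAt X m m)).IsInvertible ∧
      ∀ p ∈ (chartAt X m).source, chartAt X m p ∈ O → ∀ v : TangentSpace 𝓘(ℂ, X) p,
        v ∈ E p ↔ T (chartAt X m p) (mfderiv 𝓘(ℂ, X) 𝓘(ℂ, X) (chartAt X m) p v) ∈ K := by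
  obtain ⟨e, hme, hlin, hea, -, K, hK, hEK⟩ := hE m
  set κ := chartAt X m with hκ
  have hκd : κ.MDifferentiable 𝓘(ℂ, X) 𝓘(ℂ, X) := mdifferentiable_chart m
  have hmκ : m ∈ κ.source := mem_chart_source X m
  set O : Set X := κ.target ∩ κ.symm ⁻¹' e.baseSet with hO
  have hOo : IsOpen O := κ.isOpen_inter_preimage_symm e.open_baseSet
  have hmO : κ m ∈ O := ⟨κ.map_source hmκ, by simpa [κ.left_inv hmκ] using hme⟩
  -- `τ` is the inverse of the chart of the tangent bundle induced by `κ`; its second coordinate in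
  -- the trivialization `e` is jointly analytic and linear in the fibre variable.
  set τ : X × X → TangentBundle 𝓘(ℂ, X) M := fun q =>
    ⟨κ.symm q.1, mfderiv 𝓘(ℂ, X) 𝓘(ℂ, X) κ.symm q.1 q.2⟩ with hτ
  set G : X × X → X := fun q => (e (τ q)).2 with hG
  have hτω : ContMDiffOn 𝓘(ℂ, X × X) 𝓘(ℂ, X).tangent ω τ (O ×ˢ Set.univ) := by
    have h1 : ContMDiffOn 𝓘(ℂ, X) 𝓘(ℂ, X) ω κ.symm O :=
      contMDiffOn_chart_symm.mono Set.inter_subset_left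
    have h2 := h1.contMDiffOn_tangentMapWithin (m := ω) (by simp) hOo.uniqueMDiffOn
    have h3 := h2.comp contMDiff_tangentBundle_mk.contMDiffOn
      (s := (O ×ˢ Set.univ : Set (X × X))) fun q hq => hq.1
    refine h3.congr fun q hq => ?_
    change _ = Bundle.TotalSpace.mk (κ.symm q.1) (mfderivWithin 𝓘(ℂ, X) 𝓘(ℂ, X) κ.symm O q.1 q.2)
    rw [mfderivWithin_of_isOpen hOo hq.1]
  have hGω : ContDiffOn ℂ ω G (O ×ˢ Set.univ) :=
    (contMDiff_snd.comp_contMDiffOn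
      (hea.comp hτω fun q hq => e.mem_source.2 hq.1.2)).contDiffOn
  have hGlin : ∀ x ∈ O, ∃ L : X →L[ℂ] X, ∀ v, G (x, v) = L v := by
    intro x hx
    refine ⟨(e.continuousLinearMapAt ℂ (κ.symm x)).comp (mfderiv 𝓘(ℂ, X) 𝓘(ℂ, X) κ.symm x), ?_⟩
    intro v
    exact (e.continuousLinearMapAt_apply_of_mem (R := ℂ) hx.2 _).symm
  have hOu : IsOpen (O ×ˢ (Set.univ : Set X)) := hOo.prod isOpen_univ
  have hGat : ∀ x ∈ O, ContDiffAt ℂ ω G (x, 0) := fun x hx =>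
    hGω.contDiffAt (hOu.mem_nhds ⟨hx, trivial⟩)
  -- As a partial derivative of `G`, the family of fibre maps is analytic for the operator norm.
  set T : X → X →L[ℂ] X := fun x => (fderiv ℂ G (x, 0)).comp (ContinuousLinearMap.inr ℂ X X) with hT
  have hTG : ∀ x ∈ O, ∀ v, T x v = G (x, v) := by
    intro x hx v
    obtain ⟨L, hL⟩ := hGlin x hx
    have h1 : HasFDerivAt (fun v => G (x, v)) (T x) 0 :=
      HasFDerivAt.comp (g := G) 0 ((hGat x hx).differentiableAt (by simp)).hasFDerivAt
        (hasFDerivAt_prodMk_right x (0 : X))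
    have h2 : HasFDerivAt (fun v => G (x, v)) L 0 := by
      rw [funext hL]
      exact L.hasFDerivAt
    rw [h1.unique h2, hL]
  have hτκ : ∀ p ∈ κ.source, ∀ v : TangentSpace 𝓘(ℂ, X) p,
      τ (κ p, mfderiv 𝓘(ℂ, X) 𝓘(ℂ, X) κ p v) = ⟨p, v⟩ := by
    intro p hp v
    have hmk : ∀ (q : M) (w : X), q = p → w = v →
        (⟨q, w⟩ : TangentBundle 𝓘(ℂ, X) M) = ⟨p, v⟩ := by
      rintro q w rfl rfl
      rfl
    exact hmk _ _ (κ.left_inv hp) (congrArg (fun l : X →L[ℂ] X => l v) (hκd.symm_comp_deriv hp))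
  refine ⟨T, K, O, hK, hOo.mem_nhds hmO, ?_, ?_, fun p hp hpO v => ?_⟩
  · have h1 : ContDiffAt ℂ ω (fderiv ℂ G) (κ m, 0) := (hGat _ hmO).fderiv_right (by simp)
    have h2 : ContDiffAt ℂ ω (fun x : X => (x, (0 : X))) (κ m) :=
      contDiffAt_id.prodMk contDiffAt_const
    exact (ContDiffAt.comp (g := fderiv ℂ G) (κ m) h1 h2).clm_comp contDiffAt_const
  · refine ⟨((hκd.mfderiv hmκ).symm.trans (e.continuousLinearEquivAt ℂ m hme) : X ≃L[ℂ] X), ?_⟩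
    refine ContinuousLinearMap.ext fun w => ?_
    obtain ⟨v, rfl⟩ : ∃ v : TangentSpace 𝓘(ℂ, X) m, hκd.mfderiv hmκ v = w :=
      (hκd.mfderiv hmκ).surjective w
    have h1 : (e ⟨m, (hκd.mfderiv hmκ).symm (hκd.mfderiv hmκ v)⟩).2 =
        (e (τ (κ m, mfderiv 𝓘(ℂ, X) 𝓘(ℂ, X) κ m v))).2 := by
      rw [hτκ m hmκ, ContinuousLinearEquiv.symm_apply_apply]
    exact h1.trans (hTG _ hmO _).symm
  · have hpe : p ∈ e.baseSet := by simpa [κ.left_inv hp] using hpO.2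
    have h1 : T (κ p) (mfderiv 𝓘(ℂ, X) 𝓘(ℂ, X) κ p v) = (e ⟨p, v⟩).2 :=
      (hTG _ hpO _).trans (congrArg (fun w => (e w).2) (hτκ p hp v))
    exact (hEK p hpe v).trans (iff_of_eq (congrArg (· ∈ K) h1.symm))

/-- An involutive holomorphic subbundle is constant in a suitable holomorphic chart around each
point: the chart of `M` is composed with a map that straightens the subbundle in coordinates. Vector
fields on the model space are pulled back to `M` to apply the involutivity there. -/
theorem exists_flat_chart [CompleteSpace X]
    {E : ∀ p : M, Submodule ℂ (TangentSpace 𝓘(ℂ, X) p)} (hE : IsHolomorphicSubbundle E)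
    (hinv : IsHolomorphicallyInvolutive E) (m : M) :
    ∃ φ ∈ IsManifold.maximalAtlas 𝓘(ℂ, X) ω M, m ∈ φ.source ∧
      ∃ K : Submodule ℂ X, K.ClosedComplemented ∧ ∀ p ∈ φ.source,
        ∀ v : TangentSpace 𝓘(ℂ, X) p, v ∈ E p ↔ mfderiv 𝓘(ℂ, X) 𝓘(ℂ, X) φ p v ∈ K := by
  obtain ⟨T, K, O, hK, hO, hT, hT₀, hET⟩ := hE.exists_coordinates m
  set κ := chartAt X m with hκ
  have hκd : κ.MDifferentiable 𝓘(ℂ, X) 𝓘(ℂ, X) := mdifferentiable_chart m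
  have hmκ : m ∈ κ.source := mem_chart_source X m
  have hκω : ∀ p ∈ κ.source, ContMDiffAt 𝓘(ℂ, X) 𝓘(ℂ, X) ω κ p := fun p hp =>
    contMDiffOn_chart.contMDiffAt (κ.open_source.mem_nhds hp)
  have hκi : ∀ p ∈ κ.source, (mfderiv 𝓘(ℂ, X) 𝓘(ℂ, X) κ p).IsInvertible := fun p hp =>
    ⟨hκd.mfderiv hp, rfl⟩
  have hpull : ∀ p ∈ κ.source, ∀ ξ : X → X, mfderiv 𝓘(ℂ, X) 𝓘(ℂ, X) κ p
      (VectorField.mpullback 𝓘(ℂ, X) 𝓘(ℂ, X) κ (ξ : ∀ x : X, TangentSpace 𝓘(ℂ, X) x) p) =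
        ξ (κ p) := fun p hp ξ => (hκi p hp).self_apply_inverse _
  obtain ⟨Θ, hΘm, hΘO, hΘ, hΘ', hΘK⟩ := exists_straightening_of_involutive hK hT.analyticAt hT₀
    (Filter.inter_mem hO (κ.open_target.mem_nhds (κ.map_source hmκ))) (by
      intro V hV hVO ξ η hξ hη hξK hηK x hx
      have hxt := (hVO hx).2
      set V' : Set M := κ.source ∩ κ ⁻¹' V with hV'
      have hfield : ∀ ξ : X → X, ContDiffOn ℂ ω ξ V → IsHolomorphicVectorFieldOn
          (VectorField.mpullback 𝓘(ℂ, X) 𝓘(ℂ, X) κ (ξ : ∀ x : X, TangentSpace 𝓘(ℂ, X) x)) V' := by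
        intro ξ hξ p hp
        refine (ContMDiffAt.mpullback_vectorField_preimage ?_ (hκω p hp.1) (hκi p hp.1)
          (by simp)).contMDiffWithinAt
        exact contMDiffAt_vectorSpace_iff_contDiffAt.2 (hξ.contDiffAt (hV.mem_nhds hp.2))
      have hmem : ∀ ξ : X → X, (∀ x ∈ V, T x (ξ x) ∈ K) → ∀ p ∈ V',
          VectorField.mpullback 𝓘(ℂ, X) 𝓘(ℂ, X) κ (ξ : ∀ x : X, TangentSpace 𝓘(ℂ, X) x) p ∈ E p := by
        intro ξ hξ p hp
        rw [hET p hp.1 (hVO hp.2).1, hpull p hp.1]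
        exact hξ _ hp.2
      set p := κ.symm x with hp
      have hpx : κ p = x := κ.right_inv hxt
      have hpV' : p ∈ V' := ⟨κ.map_target hxt, by rwa [Set.mem_preimage, hpx]⟩
      have hbr := hinv V' (κ.isOpen_inter_preimage hV) _ _ (hfield ξ hξ) (hfield η hη) (hmem ξ hξK)
        (hmem η hηK) p hpV'
      have hmd : ∀ ξ : X → X, ContDiffOn ℂ ω ξ V → MDifferentiableAt 𝓘(ℂ, X) 𝓘(ℂ, X).tangent
          (fun y => (⟨y, ξ y⟩ : TangentBundle 𝓘(ℂ, X) X)) (κ p) := fun ξ hξ =>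
        (contMDiffAt_vectorSpace_iff_contDiffAt.2
          (hξ.contDiffAt (hV.mem_nhds hpV'.2))).mdifferentiableAt (by simp)
      rw [← VectorField.mpullback_mlieBracket (hmd ξ hξ) (hmd η hη) (hκω p hpV'.1)
        (by simp), hET p hpV'.1 (hVO hpV'.2).1] at hbr
      have h1 := (hpull p hpV'.1 (VectorField.mlieBracket 𝓘(ℂ, X) ξ η)).trans
        (congrFun (VectorField.mlieBracket_eq_lieBracket (V := ξ) (W := η)) (κ p))
      have hbr' : T (κ p) (VectorField.lieBracket ℂ ξ η (κ p)) ∈ K :=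
        (iff_of_eq (congrArg (fun w : X => T (κ p) w ∈ K) h1)).1 hbr
      rwa [hpx] at hbr')
  have hmaps : ∀ p ∈ (κ.trans Θ).source, p ∈ κ.source ∧ κ p ∈ Θ.source := fun p hp => by
    simpa using hp
  refine ⟨κ.trans Θ, (κ.trans Θ).mem_maximalAtlas_of_contMDiffOn ?_ ?_, by simp [hmκ, hΘm],
    K, hK, ?_⟩
  · exact hΘ.contMDiffOn.comp (contMDiffOn_chart.mono fun p hp => (hmaps p hp).1)
      fun p hp => (hmaps p hp).2
  · exact contMDiffOn_chart_symm.comp (hΘ'.contMDiffOn.mono fun y hy => hy.1) fun y hy => hy.2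
  · intro p hp v
    obtain ⟨hpκ, hpΘ⟩ := hmaps p hp
    have hΘd : MDifferentiableAt 𝓘(ℂ, X) 𝓘(ℂ, X) Θ (κ p) :=
      ((hΘ.contDiffAt (Θ.open_source.mem_nhds hpΘ)).differentiableAt (by simp)).mdifferentiableAt
    refine (hET p hpκ (hΘO hpΘ).1 v).trans ((hΘK _ hpΘ _).trans ?_)
    rw [OpenPartialHomeomorph.coe_trans, mfderiv_comp p hΘd (hκd.mdifferentiableAt hpκ),
      mfderiv_eq_fderiv]
    rfl

end Manifold

theorem theorem6 {X : Type u} [NormedAddCommGroup X] [NormedSpace ℂ X] [CompleteSpace X]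
    {M : Type v} [TopologicalSpace M] [ChartedSpace X M] [IsManifold 𝓘(ℂ, X) ω M]
    (E : ∀ p : M, Submodule ℂ (TangentSpace 𝓘(ℂ, X) p))
    (hE : IsHolomorphicSubbundle E) (hinv : IsHolomorphicallyInvolutive E) (m : M) :
    ∃ U : Set M, IsOpen U ∧ m ∈ U ∧
      ∃ (F : Type u) (_ : NormedAddCommGroup F) (_ : NormedSpace ℂ F) (_ : CompleteSpace F)
        (ζ : M → F),
        (∀ p ∈ U, Manifold.IsSubmersionAt 𝓘(ℂ, X) 𝓘(ℂ, F) ω ζ p) ∧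
        ∀ p ∈ U,
          E p = (mfderiv 𝓘(ℂ, X) 𝓘(ℂ, F) ζ p).ker ∧
          IsSubmanifoldTangentSpaceAt {q ∈ U | ζ q = ζ p} p (E p) := by
  obtain ⟨φ, hφ, hm, K, hK, hEφ⟩ := exists_flat_chart hE hinv m
  obtain ⟨K', _, hK', ι, hι⟩ := hK.exists_banach_splitting
  set π : X →L[ℂ] K' := (ContinuousLinearMap.snd ℂ K K').comp (ι : X →L[ℂ] K × K') with hπ
  have hπK : ∀ v, v ∈ K ↔ π v = 0 := hι
  refine ⟨φ.source, φ.open_source, hm, K', inferInstance, inferInstance, hK', fun p => π (φ p),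
    fun p hp => ?_, fun p hp => ⟨?_, ⟨⟨hp, rfl⟩, φ, hφ, hp, K, hK, fun q hq => ?_, hEφ p hp⟩⟩⟩
  · refine ⟨K, inferInstance, inferInstance, Manifold.IsSubmersionAtOfComplement.mk_of_charts
      (ι.trans (ContinuousLinearEquiv.prodComm ℂ K K')) φ (OpenPartialHomeomorph.refl K') hp
      trivial hφ (IsManifold.subset_maximalAtlas rfl) (fun _ _ => trivial) fun x hx => ?_⟩
    have hx' : x ∈ φ.target := by simpa using hx
    change π (φ (φ.symm x)) = π x
    rw [φ.right_inv hx']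
  · have hφd : MDifferentiableAt 𝓘(ℂ, X) 𝓘(ℂ, X) φ p :=
      (contMDiffAt_of_mem_maximalAtlas hφ hp).mdifferentiableAt (by simp)
    have hd : mfderiv 𝓘(ℂ, X) 𝓘(ℂ, K') (fun p => π (φ p)) p =
        π.comp (mfderiv 𝓘(ℂ, X) 𝓘(ℂ, X) φ p) := by
      have := mfderiv_comp (I'' := 𝓘(ℂ, K')) (g := π) p π.differentiableAt.mdifferentiableAt hφd
      rw [mfderiv_eq_fderiv, π.fderiv] at this
      exact this
    ext v
    refine (hEφ p hp v).trans ((hπK _).trans ?_)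
    rw [hd]
    rfl
  · change (q ∈ φ.source ∧ π (φ q) = π (φ p)) ↔ _
    rw [hπK, map_sub, sub_eq_zero, and_iff_right hq]
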